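/- For $p\in(0,1)$ let $\mu_p$ be the product measure on $\{0,1\}^n$ under which each bit equals $1$ with probability $p$, and write $\|h\|_{\mu_p}^2=\mathbb{E}_{x\sim\mu_p}[h(x)^2]$. A function $f\colon\{0,1\}^n\to\mathbb{R}$ has degree at most $d$ if it is a multilinear polynomial of degree at most $d$ in the bits $y_1,\dots,y_n$. For $S\subseteq[n]$, the $p$-biased Fourier coefficient of $f$ at $S$ is $\hat f_p(S)=\mathbb{E}_{\mu_p}[f\chi_S^{(p)}]$, where $\chi_S^{(p)}=\prod_{i\in S}\frac{p-y_i}{\sqrt{p(1-p)}}$ (for $p=1/2$ this is $\prod_{i\in S}x_i$ with $x_i=1-2y_i\in\{\pm1\}$). Let $d\ge 0$ be an integer and let $A\subset\mathbb{R}$ be a finite non-empty set. Then there are a function $C\colon(0,1)\to\mathbb{R}$, continuous on $(0,1)$, an integer $M$, a finite set $B_p\subset\mathbb{R}$ for each $p\in(0,1)$, and a constant $K$, all depending only on $d$ and $A$, such that the following hold for every $n\ge 0$. 1. For every $p\in(0,1)$ and every $f\colon\{0,1\}^n\to\mathbb{R}$ of degree at most $d$, with $\epsilon:=\mathbb{E}_{\mu_p}[\operatorname{dist}(f,A)^2]$,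 where $\operatorname{dist}(t,A)=\min_{a\in A}|t-a|$, there is a function $g\colon\{0,1\}^n\to A$ of degree at most $d$ with $\|f-g\|_{\mu_p}^2\le C(p)\,\epsilon$. 2. Every function $g\colon\{0,1\}^n\to A$ of degree at most $d$ depends on at most $M$ coordinates, and $\hat g_p(S)\in B_p$ for all $p\in(0,1)$ and all $S\subseteq[n]$. 3. For every $F\colon\{0,1\}^n\to A$ there is a function $g\colon\{0,1\}^n\to A$ of degree at most $d$, with $\hat g_{1/2}(S)\in B_{1/2}$ for all $S\subseteq[n]$, such that $\|F-g\|_{\mu_{1/2}}^2\le K\,\|F^{>d}\|_{\mu_{1/2}}^2$, where $F^{>d}=\sum_{|S|>d}\hat F_{1/2}(S)\,\chi_S^{(1/2)}$. -/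

import Mathlib

noncomputable section

namespace BiasedCube

/-- The hypercube `{0,1}^n` (`true` is the bit `1`). -/
abbrev Cube (n : ℕ) : Type := Fin n → Bool

/-- The `i`-th bit of `x`, as a real number. -/
def bit {n : ℕ} (x : Cube n) (i : Fin n) : ℝ := if x i then 1 else 0

/-- The `μ_p`-probability of `x`: the bits are independent, each equal to `1` with
probability `p`. -/
def weight {n : ℕ} (p : ℝ) (x : Cube n) : ℝ := ∏ i, if x i then p else 1 - p

/-- Expectation with respect to `μ_p`. -/
def expect {n : ℕ} (p : ℝ) (f : Cube n → ℝ) : ℝ := ∑ x, weight p x * f x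

/-- The squared `L²(μ_p)` norm. -/
def normSq {n : ℕ} (p : ℝ) (f : Cube n → ℝ) : ℝ := expect p (fun x => f x ^ 2)

/-- The monomial `y_S = ∏_{i ∈ S} y_i` in the bits. -/
def monomial {n : ℕ} (S : Finset (Fin n)) (x : Cube n) : ℝ := ∏ i ∈ S, bit x i

/-- `f` has degree at most `d`: it is a multilinear polynomial in the bits all of whose
monomials have at most `d` variables. -/
def DegreeLE {n : ℕ} (d : ℕ) (f : Cube n → ℝ) : Prop :=
  ∃ c : Finset (Fin n) → ℝ, (∀ S, d < S.card → c S = 0) ∧ ∀ x, f x = ∑ S, c S * monomial S x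

/-- All values of `f` lie in `A`. -/
def ValuedIn {n : ℕ} (A : Finset ℝ) (f : Cube n → ℝ) : Prop := ∀ x, f x ∈ A

/-- `f` depends on at most `M` coordinates. -/
def IsJunta {n : ℕ} (M : ℕ) (f : Cube n → ℝ) : Prop :=
  ∃ J : Finset (Fin n), J.card ≤ M ∧ ∀ x y : Cube n, (∀ i ∈ J, x i = y i) → f x = f y

/-- The squared `μ_p`-distance of `f` from the set `A`: the expectation of `dist(f, A)²`. -/
def distSq {n : ℕ} (p : ℝ) (f : Cube n → ℝ) (A : Finset ℝ) : ℝ :=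
  expect p (fun x => Metric.infDist (f x) (A : Set ℝ) ^ 2)

/-- The `p`-biased Fourier character `∏_{i ∈ S} (p - y_i) / √(p(1-p))`. For `p = 1/2` this is
`∏_{i ∈ S} x_i` in the signs `x_i = 1 - 2 y_i`. -/
def character {n : ℕ} (p : ℝ) (S : Finset (Fin n)) (x : Cube n) : ℝ :=
  ∏ i ∈ S, (p - bit x i) / Real.sqrt (p * (1 - p))

/-- The `p`-biased Fourier coefficient of `f` at `S`. -/
def fourierCoeff {n : ℕ} (p : ℝ) (f : Cube n → ℝ) (S : Finset (Fin n)) : ℝ :=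
  expect p (fun x => f x * character p S x)

/-- The part `f^{>d}` of the `p`-biased Fourier expansion of `f` above level `d`. -/
def highPart {n : ℕ} (p : ℝ) (d : ℕ) (f : Cube n → ℝ) (x : Cube n) : ℝ :=
  ∑ S with d < Finset.card S, fourierCoeff p f S * character p S x

end BiasedCube

end

/-!
A function of degree at most `d` that is close to a finite set `A` is close to an `A`-valued one.

Throughout, `p` is restricted by `s ≤ p * (1 - p)` for a fixed `s > 0`, and all constants depend
only on `d`, `A` and `s`. Everything rests on hypercontractivity (`expect_pow_four_le`): functions
of degree at most `d` satisfy `𝔼 f⁴ ≤ K (𝔼 f²)²` with `K` independent of the dimension.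

Since `A` is discrete, `(t - a)² ≤ dist(t, A)² + L (t - a)⁴` for `a ∈ A`. Taking expectations and
applying hypercontractivity gives a dichotomy (`exists_dichotomy`): `𝔼 (f - a)²` is either at most
`2ε`, where `ε = 𝔼 dist(f, A)²`, or bounded below. Three consequences follow.

* Each derivative of `f` is close to the finite set `A - A`, which contains `0`, so each influence
  of `f` is either `O(ε)` or bounded below (`exists_influence_dichotomy`). As the total influence is
  at most `d 𝔼 f² / (p (1 - p))`, only boundedly many coordinates `J` have a large influence.
* The variance of `f` is either `O(ε)` or bounded below. Applying this to the restrictions of `f`,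
  and using hypercontractivity once more, the same holds for the conditional variance
  `W(T) = ‖f - 𝔼[f | coordinates outside T]‖²`, for every `T` (`exists_average_dichotomy`).
* For small `ε`, let `T` grow from `∅` to the complement of `J`, one coordinate at a time. Each step
  keeps `W(T)` below the gap, so `W(T) ≤ 4ε` to the end (`exists_junta_approx`): `f` is close to its
  average `m` over the coordinates outside `J`, which has degree at most `d`.

Now let `g` be the pointwise rounding of `m` to `A`. It is an `A`-valued junta close to `m`. The
Möbius coefficients of `g` lie in a fixed finite set, and those above level `d` are close to those
of `m`, which vanish; hence they vanish and `g` has degree at most `d`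
(`exists_degreeLE_of_close`). If `ε` is not small, a constant `g` suffices.

For an `A`-valued `g` of degree at most `d` one has `ε = 0`, so every influence is zero or bounded
below and `g` is a junta (`exists_dependsOn`); its Fourier coefficients are then sums of boundedly
many terms from a finite set. For an `A`-valued `F` the approximation theorem is applied to the
low-degree part of `F`, whose distance to `A` is at most the norm of the high-degree part.
-/

namespace BiasedCube

open Finset Function

variable {n d : ℕ} {p s : ℝ}

/-! ### Expectations under the biased product measure -/

lemma weight_nonneg (hp : p ∈ Set.Icc (0 : ℝ) 1) (x : Cube n) : 0 ≤ weight p x := by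
  refine prod_nonneg fun i _ => ?_
  split_ifs
  · exact hp.1
  · linarith [hp.2]

lemma expect_prod (φ : Fin n → Bool → ℝ) :
    expect p (fun x => ∏ i, φ i (x i)) = ∏ i, (p * φ i true + (1 - p) * φ i false) := by
  have h := Finset.prod_univ_sum (fun _ : Fin n => (univ : Finset Bool))
    (fun i b => (if b then p else 1 - p) * φ i b)
  simp only [Fintype.sum_bool, Fintype.piFinset_univ, prod_mul_distrib] at h
  simpa [expect, weight] using h.symm

lemma expect_const (c : ℝ) : expect p (fun _ : Cube n => c) = c := by
  have h := expect_prod (p := p) (fun (_ : Fin n) _ => (1 : ℝ))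
  simp only [prod_const_one, mul_one, add_sub_cancel] at h
  calc expect p (fun _ : Cube n => c) = expect p (fun _ : Cube n => (1 : ℝ)) * c := by
        simp [expect, sum_mul]
    _ = c := by rw [h, one_mul]

lemma expect_add (f g : Cube n → ℝ) :
    expect p (fun x => f x + g x) = expect p f + expect p g := by
  simp [expect, mul_add, sum_add_distrib]

lemma expect_sub (f g : Cube n → ℝ) :
    expect p (fun x => f x - g x) = expect p f - expect p g := by
  simp [expect, mul_sub, sum_sub_distrib]

lemma expect_const_mul (c : ℝ) (f : Cube n → ℝ) :
    expect p (fun x => c * f x) = c * expect p f := by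
  simp [expect, mul_sum, mul_left_comm]

lemma expect_sum {ι : Type*} (t : Finset ι) (f : ι → Cube n → ℝ) :
    expect p (fun x => ∑ i ∈ t, f i x) = ∑ i ∈ t, expect p (f i) := by
  simp only [expect, mul_sum]
  exact sum_comm

lemma expect_mono (hp : p ∈ Set.Icc (0 : ℝ) 1) {f g : Cube n → ℝ} (h : ∀ x, f x ≤ g x) :
    expect p f ≤ expect p g :=
  sum_le_sum fun x _ => mul_le_mul_of_nonneg_left (h x) (weight_nonneg hp x)

lemma expect_nonneg (hp : p ∈ Set.Icc (0 : ℝ) 1) {f : Cube n → ℝ} (h : ∀ x, 0 ≤ f x) :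
    0 ≤ expect p f :=
  sum_nonneg fun x _ => mul_nonneg (weight_nonneg hp x) (h x)

lemma normSq_nonneg (hp : p ∈ Set.Icc (0 : ℝ) 1) (f : Cube n → ℝ) : 0 ≤ normSq p f :=
  expect_nonneg hp fun _ => sq_nonneg _

lemma distSq_nonneg (hp : p ∈ Set.Icc (0 : ℝ) 1) (f : Cube n → ℝ) (A : Finset ℝ) :
    0 ≤ distSq p f A :=
  expect_nonneg hp fun _ => sq_nonneg _

/-- Cauchy–Schwarz. -/
lemma expect_mul_sq_le (hp : p ∈ Set.Icc (0 : ℝ) 1) (f g : Cube n → ℝ) :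
    expect p (fun x => f x * g x) ^ 2 ≤
      expect p (fun x => f x ^ 2) * expect p (fun x => g x ^ 2) :=
  sum_sq_le_sum_mul_sum_of_sq_le_mul _
    (fun x _ => mul_nonneg (weight_nonneg hp x) (sq_nonneg _))
    (fun x _ => mul_nonneg (weight_nonneg hp x) (sq_nonneg _)) fun x _ => by
      apply le_of_eq; ring

lemma expect_sq_le (hp : p ∈ Set.Icc (0 : ℝ) 1) (f : Cube n → ℝ) :
    expect p f ^ 2 ≤ expect p (fun x => f x ^ 2) := by
  simpa [expect_const] using expect_mul_sq_le hp f (fun _ => 1)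

lemma normSq_add_le (hp : p ∈ Set.Icc (0 : ℝ) 1) (f g : Cube n → ℝ) :
    normSq p (fun x => f x + g x) ≤ 2 * normSq p f + 2 * normSq p g := by
  simp only [normSq]
  rw [← expect_const_mul, ← expect_const_mul, ← expect_add]
  exact expect_mono hp fun x => by nlinarith [sq_nonneg (f x - g x)]

/-- Resampling the coordinates in `T` preserves the measure: exchanging the coordinates in `T`
of two independent points is a measure-preserving involution. -/
lemma expect_expect_piecewise (T : Finset (Fin n)) (F : Cube n → ℝ) :
    expect p (fun x => expect p (fun y => F (T.piecewise y x))) = expect p F := by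
  have hinv : Involutive fun z : Cube n × Cube n => (T.piecewise z.2 z.1, T.piecewise z.1 z.2) := by
    rintro ⟨x, y⟩
    ext i <;> by_cases hi : i ∈ T <;> simp [hi]
  have hw (x y : Cube n) :
      weight p (T.piecewise y x) * weight p (T.piecewise x y) = weight p x * weight p y := by
    simp only [weight, ← prod_mul_distrib]
    refine prod_congr rfl fun i _ => ?_
    by_cases hi : i ∈ T <;> simp [hi, mul_comm]
  calc expect p (fun x => expect p (fun y => F (T.piecewise y x)))
      = ∑ z : Cube n × Cube n, weight p (T.piecewise z.2 z.1) * weight p (T.piecewise z.1 z.2)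
          * F (T.piecewise z.2 z.1) := by
        simp only [hw, Fintype.sum_prod_type, expect, mul_sum, mul_assoc]
    _ = ∑ z : Cube n × Cube n, weight p z.1 * weight p z.2 * F z.1 :=
        Fintype.sum_equiv hinv.toPerm _ _ fun z => rfl
    _ = expect p (fun x => expect p (fun _ : Cube n => F x)) := by
        simp only [Fintype.sum_prod_type, expect, mul_sum, mul_assoc]
    _ = expect p F := by simp only [expect_const]

lemma expect_update (i : Fin n) (F : Cube n → ℝ) :
    expect p F = p * expect p (fun x => F (update x i true)) +
      (1 - p) * expect p (fun x => F (update x i false)) := by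
  have hcoord (ψ : Bool → ℝ) :
      expect p (fun y : Cube n => ψ (y i)) = p * ψ true + (1 - p) * ψ false := by
    have h := expect_prod (p := p) (fun (j : Fin n) b => if j = i then ψ b else 1)
    have h' (j : Fin n) :
        p * (if j = i then ψ true else 1) + (1 - p) * (if j = i then ψ false else 1) =
          if j = i then p * ψ true + (1 - p) * ψ false else 1 := by
      split_ifs <;> ring
    simp only [h', prod_ite_eq', mem_univ, if_true] at h
    exact h
  rw [← expect_expect_piecewise {i} F, ← expect_const_mul, ← expect_const_mul, ← expect_add]
  congr 1
  ext x
  simp only [piecewise_singleton]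
  exact hcoord fun b => F (update x i b)

/-! ### Discrete derivatives and averages -/

/-- The discrete derivative of `f` in the direction of the `i`-th bit. -/
def discreteDeriv (i : Fin n) (f : Cube n → ℝ) (x : Cube n) : ℝ :=
  f (update x i true) - f (update x i false)

/-- The conditional expectation of `f` given the coordinates outside `T`: the coordinates in `T`
are resampled. It is again a function on the whole cube. -/
def average (p : ℝ) (T : Finset (Fin n)) (f : Cube n → ℝ) (x : Cube n) : ℝ :=
  expect p (fun y => f (T.piecewise y x))

lemma average_singleton (i : Fin n) (f : Cube n → ℝ) (x : Cube n) :
    average p {i} f x = p * f (update x i true) + (1 - p) * f (update x i false) := by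
  rw [average, expect_update i]
  simp [piecewise_singleton, expect_const]

/-- The decomposition of `f` along the `i`-th bit, into parts that do not depend on it. -/
lemma eq_average_add (i : Fin n) (f : Cube n → ℝ) (x : Cube n) :
    f x = average p {i} f x + (bit x i - p) * discreteDeriv i f x := by
  rw [average_singleton, discreteDeriv, bit]
  cases h : x i
  · nth_rewrite 1 [← update_eq_self i x]
    rw [h]; simp; ring
  · nth_rewrite 1 [← update_eq_self i x]
    rw [h]; simp; ring

lemma average_insert {i : Fin n} {T : Finset (Fin n)} (hi : i ∉ T) (f : Cube n → ℝ) (x : Cube n) :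
    average p (insert i T) f x = average p T (average p {i} f) x := by
  have hup (y : Cube n) (b : Bool) : T.piecewise (update y i b) x = T.piecewise y x := by
    ext j
    by_cases hj : j ∈ T
    · have : j ≠ i := fun h => hi (h ▸ hj)
      simp [hj, this]
    · simp [hj]
  simp only [average, piecewise_insert, piecewise_singleton]
  rw [expect_update i]
  simp only [hup, update_self]
  rw [← expect_const_mul, ← expect_const_mul, ← expect_add]
  congr 1
  ext y
  rw [expect_update i]
  simp [expect_const]

lemma average_sub (T : Finset (Fin n)) (f g : Cube n → ℝ) (x : Cube n) :
    average p T (fun y => f y - g y) x = average p T f x - average p T g x :=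
  expect_sub _ _

lemma average_piecewise (T : Finset (Fin n)) (f : Cube n → ℝ) (x y : Cube n) :
    average p T f (T.piecewise y x) = average p T f x := by
  simp [average]

lemma normSq_average_le (hp : p ∈ Set.Icc (0 : ℝ) 1) (T : Finset (Fin n)) (f : Cube n → ℝ) :
    normSq p (average p T f) ≤ normSq p f := by
  rw [normSq, normSq, ← expect_expect_piecewise T (fun x => f x ^ 2)]
  exact expect_mono hp fun x => expect_sq_le hp _

lemma normSq_sub_average_singleton_le (hp : p ∈ Set.Icc (0 : ℝ) 1) (i : Fin n)
    (f : Cube n → ℝ) :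
    normSq p (fun x => f x - average p {i} f x) ≤ normSq p (discreteDeriv i f) := by
  refine expect_mono hp fun x => ?_
  dsimp only
  have hb : (bit x i - p) ^ 2 ≤ 1 := by
    rw [sq_le_one_iff_abs_le_one, abs_le, bit]
    split_ifs <;> constructor <;> linarith [hp.1, hp.2]
  rw [sub_eq_of_eq_add' (eq_average_add (p := p) i f x), mul_pow]
  exact mul_le_of_le_one_left (sq_nonneg _) hb

/-! ### The degree of a function on the cube -/

namespace DegreeLE

lemma monomial {S : Finset (Fin n)} (hS : S.card ≤ d) : DegreeLE d (monomial S) := by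
  refine ⟨fun R => if R = S then 1 else 0, fun R hR => if_neg ?_, fun x => by simp⟩
  rintro rfl
  omega

lemma add {f g : Cube n → ℝ} (hf : DegreeLE d f) (hg : DegreeLE d g) :
    DegreeLE d (fun x => f x + g x) := by
  obtain ⟨b, hb, hb'⟩ := hf
  obtain ⟨c, hc, hc'⟩ := hg
  refine ⟨b + c, fun S hS => by simp [hb S hS, hc S hS], fun x => ?_⟩
  simp [hb', hc', add_mul, sum_add_distrib]

lemma const_mul {f : Cube n → ℝ} (hf : DegreeLE d f) (a : ℝ) :
    DegreeLE d (fun x => a * f x) := by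
  obtain ⟨b, hb, hb'⟩ := hf
  refine ⟨fun S => a * b S, fun S hS => by simp [hb S hS], fun x => ?_⟩
  simp [hb', mul_sum, mul_assoc]

lemma sub {f g : Cube n → ℝ} (hf : DegreeLE d f) (hg : DegreeLE d g) :
    DegreeLE d (fun x => f x - g x) := by
  simpa [sub_eq_add_neg] using hf.add (hg.const_mul (-1))

lemma const (a : ℝ) : DegreeLE d (fun _ : Cube n => a) := by
  simpa [BiasedCube.monomial] using
    (monomial (n := n) (d := d) (S := ∅) (by simp)).const_mul a

lemma sum {ι : Type*} (t : Finset ι) {f : ι → Cube n → ℝ} (h : ∀ i ∈ t, DegreeLE d (f i)) :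
    DegreeLE d (fun x => ∑ i ∈ t, f i x) := by
  classical
  induction t using Finset.induction_on with
  | empty => simpa using const 0
  | insert a t ha ih =>
    simp only [sum_insert ha]
    exact (h a (mem_insert_self a t)).add (ih fun i hi => h i (mem_insert_of_mem hi))

/-- A linear operation that maps monomials of degree at most `d` to functions of degree at most
`e` maps all functions of degree at most `d` to such functions. -/
lemma of_monomial {e m : ℕ} {f : Cube n → ℝ} (hf : DegreeLE d f)
    (L : (Cube n → ℝ) →ₗ[ℝ] (Cube m → ℝ))
    (h : ∀ S : Finset (Fin n), S.card ≤ d → DegreeLE e (L (BiasedCube.monomial S))) :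
    DegreeLE e (L f) := by
  obtain ⟨c, hc, hf⟩ := hf
  have hf' : f = ∑ S, c S • BiasedCube.monomial S := by
    ext x; simp [hf]
  have hL : L f = fun x => ∑ S, c S * L (BiasedCube.monomial S) x := by
    ext x; rw [hf', map_sum]; simp
  rw [hL]
  refine sum _ fun S _ => ?_
  by_cases hS : S.card ≤ d
  · exact (h S hS).const_mul _
  · simpa [hc S (not_le.mp hS)] using const 0

lemma comp_of_monomial {e m : ℕ} {f : Cube n → ℝ} (hf : DegreeLE d f) (φ : Cube m → Cube n)
    (h : ∀ S : Finset (Fin n), S.card ≤ d → DegreeLE e (fun x => BiasedCube.monomial S (φ x))) :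
    DegreeLE e (fun x => f (φ x)) :=
  hf.of_monomial (LinearMap.funLeft ℝ ℝ φ) h

end DegreeLE

lemma monomial_piecewise (S T : Finset (Fin n)) (x y : Cube n) :
    monomial S (T.piecewise y x) = monomial (S ∩ T) y * monomial (S \ T) x := by
  simp only [monomial]
  rw [← prod_inter_mul_prod_sdiff S T]
  congr 1
  · exact prod_congr rfl fun i hi => by simp [bit, (mem_inter.mp hi).2]
  · exact prod_congr rfl fun i hi => by simp [bit, (mem_sdiff.mp hi).2]

namespace DegreeLE

lemma piecewise_left {f : Cube n → ℝ} (hf : DegreeLE d f) (T : Finset (Fin n)) (x : Cube n) :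
    DegreeLE d (fun y => f (T.piecewise y x)) := by
  refine hf.comp_of_monomial (fun y => T.piecewise y x) fun S hS => ?_
  simp only [monomial_piecewise, mul_comm _ (BiasedCube.monomial (S \ T) x)]
  exact (monomial ((card_le_card inter_subset_left).trans hS)).const_mul _

lemma piecewise_right {f : Cube n → ℝ} (hf : DegreeLE d f) (T : Finset (Fin n)) (y : Cube n) :
    DegreeLE d (fun x => f (T.piecewise y x)) := by
  refine hf.comp_of_monomial (fun x => T.piecewise y x) fun S hS => ?_
  simp only [monomial_piecewise]
  exact (monomial ((card_le_card sdiff_subset).trans hS)).const_mul _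

lemma average {f : Cube n → ℝ} (hf : DegreeLE d f) (T : Finset (Fin n)) :
    DegreeLE d (BiasedCube.average p T f) :=
  sum _ fun y _ => (hf.piecewise_right T y).const_mul _

lemma discreteDeriv {f : Cube n → ℝ} (hf : DegreeLE d f) (i : Fin n) :
    DegreeLE d (BiasedCube.discreteDeriv i f) := by
  have h (b : Bool) := hf.piecewise_right {i} (fun _ => b)
  simp only [piecewise_singleton] at h
  exact (h true).sub (h false)

end DegreeLE

lemma discreteDeriv_monomial (i : Fin n) (S : Finset (Fin n)) (x : Cube n) :
    discreteDeriv i (monomial S) x = if i ∈ S then monomial (S.erase i) x else 0 := by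
  have h (b : Bool) : monomial S (update x i b)
      = (if i ∈ S then if b then 1 else 0 else 1) * monomial (S.erase i) x := by
    have := monomial_piecewise S {i} x (fun _ => b)
    rw [piecewise_singleton] at this
    rw [this, sdiff_singleton_eq_erase]
    congr 1
    by_cases hi : i ∈ S <;> simp [hi, monomial, bit]
  rw [discreteDeriv, h, h]
  split_ifs <;> simp_all

lemma DegreeLE.discreteDeriv_succ {f : Cube n → ℝ} (hf : DegreeLE (d + 1) f) (i : Fin n) :
    DegreeLE d (BiasedCube.discreteDeriv i f) := by
  refine hf.of_monomial (m := n)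
    (LinearMap.funLeft ℝ ℝ (fun x : Cube n => update x i true) -
      LinearMap.funLeft ℝ ℝ (fun x : Cube n => update x i false)) fun S hS => ?_
  have : (fun x => BiasedCube.discreteDeriv i (BiasedCube.monomial S) x) =
      fun x => if i ∈ S then BiasedCube.monomial (S.erase i) x else 0 :=
    funext (discreteDeriv_monomial i S)
  change DegreeLE d (fun x => BiasedCube.discreteDeriv i (BiasedCube.monomial S) x)
  rw [this]
  split_ifs with hi
  · exact DegreeLE.monomial (by rw [card_erase_of_mem hi]; omega)
  · exact DegreeLE.const 0

lemma DegreeLE.eq_const {f : Cube n → ℝ} (hf : DegreeLE 0 f) (x y : Cube n) : f x = f y := by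
  obtain ⟨c, hc, hf⟩ := hf
  rw [hf, hf]
  refine sum_congr rfl fun S _ => ?_
  rcases S.eq_empty_or_nonempty with rfl | hS
  · simp [BiasedCube.monomial]
  · rw [hc S (card_pos.mpr hS)]; simp

/-! ### Hypercontractivity and the total influence -/

lemma mem_Icc_of_le (hs : 0 < s) (hsp : s ≤ p * (1 - p)) : p ∈ Set.Icc (0 : ℝ) 1 := by
  constructor <;> nlinarith [sq_nonneg p, sq_nonneg (1 - p)]

lemma expect_add_bit_mul (i : Fin n) (Φ : ℝ → ℝ) {a b : Cube n → ℝ}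
    (ha : ∀ x c, a (update x i c) = a x) (hb : ∀ x c, b (update x i c) = b x) :
    expect p (fun x => Φ (a x + (bit x i - p) * b x)) =
      expect p (fun x => p * Φ (a x + (1 - p) * b x) + (1 - p) * Φ (a x - p * b x)) := by
  rw [expect_update i, expect_add, expect_const_mul, expect_const_mul]
  simp [ha, hb, bit, sub_eq_add_neg]

lemma expect_add_bit_mul_sq (i : Fin n) {a b : Cube n → ℝ}
    (ha : ∀ x c, a (update x i c) = a x) (hb : ∀ x c, b (update x i c) = b x) :
    normSq p (fun x => a x + (bit x i - p) * b x) = normSq p a + p * (1 - p) * normSq p b := by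
  simp only [normSq]
  rw [expect_add_bit_mul i (fun t => t ^ 2) ha hb, ← expect_const_mul, ← expect_add]
  congr 1
  ext x
  ring

lemma apply_update_congr {f : Cube n → ℝ} {i : Fin n} {T : Finset (Fin n)}
    (hf : DependsOn f (insert i T : Finset (Fin n))) {x y : Cube n}
    (hxy : ∀ j ∈ (T : Set (Fin n)), x j = y j) (b : Bool) :
    f (update x i b) = f (update y i b) := hf fun j hj => by
  by_cases hji : j = i
  · subst hji; simp
  · simpa [hji] using hxy j (by simpa [hji] using hj)

lemma average_singleton_dependsOn {f : Cube n → ℝ} {i : Fin n} {T : Finset (Fin n)}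
    (hf : DependsOn f (insert i T : Finset (Fin n))) : DependsOn (average p {i} f) T :=
  fun x y hxy => by simp only [average_singleton, apply_update_congr hf hxy]

lemma discreteDeriv_dependsOn {f : Cube n → ℝ} {i : Fin n} {T : Finset (Fin n)}
    (hf : DependsOn f (insert i T : Finset (Fin n))) : DependsOn (discreteDeriv i f) T :=
  fun x y hxy => by simp only [discreteDeriv, apply_update_congr hf hxy]

lemma update_of_dependsOn {f : Cube n → ℝ} {T : Finset (Fin n)} (hf : DependsOn f T) {i : Fin n}
    (hi : i ∉ T) (x : Cube n) (c : Bool) : f (update x i c) = f x :=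
  hf fun j hj => update_of_ne (fun h : j = i => hi (by simpa [h] using hj)) _ _

/-- The fourth moment of an affine function of one centred bit. -/
lemma fourth_moment_le (hp : p ∈ Set.Icc (0 : ℝ) 1) (a b : ℝ) :
    p * (a + (1 - p) * b) ^ 4 + (1 - p) * (a - p * b) ^ 4 ≤
      a ^ 4 + 8 * (p * (1 - p)) * (a ^ 2 * b ^ 2) + 3 * (p * (1 - p)) * b ^ 4 := by
  have hσ : 0 ≤ p * (1 - p) := mul_nonneg hp.1 (by linarith [hp.2])
  have key : a ^ 4 + 8 * (p * (1 - p)) * (a ^ 2 * b ^ 2) + 3 * (p * (1 - p)) * b ^ 4 -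
      (p * (a + (1 - p) * b) ^ 4 + (1 - p) * (a - p * b) ^ 4) =
      2 * (p * (1 - p)) * (b ^ 2 * (a - (1 - 2 * p) * b) ^ 2) +
        11 * (p * (1 - p)) ^ 2 * b ^ 4 := by ring
  have : 0 ≤ 2 * (p * (1 - p)) * (b ^ 2 * (a - (1 - 2 * p) * b) ^ 2) +
        11 * (p * (1 - p)) ^ 2 * b ^ 4 := by positivity
  linarith

/-- Hypercontractivity, by induction on the coordinates that `f` depends on. The constant
`κ = 4 / s` satisfies `κ * (p * (1 - p)) ≥ 4`, which absorbs the coefficients `8` and `3` of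
`fourth_moment_le` when the degree drops by one. -/
lemma expect_pow_four_le_of_dependsOn (hs : 0 < s) (hsp : s ≤ p * (1 - p)) (T : Finset (Fin n)) :
    ∀ (d : ℕ) (f : Cube n → ℝ), DegreeLE d f → DependsOn f T →
      expect p (fun x => f x ^ 4) ≤ (4 / s) ^ (2 * d) * normSq p f ^ 2 := by
  have hp := mem_Icc_of_le hs hsp
  have hs1 : s ≤ 1 := by nlinarith [hp.1, hp.2]
  have hκ : 4 ≤ 4 / s := by rw [le_div_iff₀ hs]; linarith
  have hconst (d : ℕ) (c : ℝ) : expect p (fun _ : Cube n => c ^ 4) ≤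
      (4 / s) ^ (2 * d) * normSq p (fun _ : Cube n => c) ^ 2 := by
    rw [normSq, expect_const, expect_const]
    have : (1 : ℝ) ≤ (4 / s) ^ (2 * d) := one_le_pow₀ (by linarith)
    nlinarith [sq_nonneg (c ^ 2)]
  induction T using Finset.induction_on with
  | empty =>
    intro d f _ hfT
    have : f = fun _ => f (fun _ => false) := funext fun x => hfT (by simp)
    rw [this]
    exact hconst d _
  | insert i T hi ih =>
    rintro (_ | d) f hf hfT
    · have : f = fun _ => f (fun _ => false) := funext fun x => hf.eq_const _ _
      rw [this]
      exact hconst 0 _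
    set a := average p {i} f with ha
    set b := discreteDeriv i f with hb
    set κ := 4 / s with hκs
    set σ := p * (1 - p) with hσ
    have haT : DependsOn a T := average_singleton_dependsOn hfT
    have hbT : DependsOn b T := discreteDeriv_dependsOn hfT
    have hfab : f = fun x => a x + (bit x i - p) * b x := funext fun x => eq_average_add i f x
    have iha := ih (d + 1) a (hf.average _) haT
    have ihb := ih d b (hf.discreteDeriv_succ i) hbT
    have hcs := expect_mul_sq_le hp (fun x => a x ^ 2) (fun x => b x ^ 2)
    simp only [← pow_mul] at hcs
    norm_num at hcs
    have hN : normSq p f = normSq p a + σ * normSq p b := by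
      conv_lhs => rw [hfab]
      exact expect_add_bit_mul_sq i (update_of_dependsOn haT hi) (update_of_dependsOn hbT hi)
    have h4 : expect p (fun x => f x ^ 4) ≤ expect p (fun x => a x ^ 4) +
        8 * σ * expect p (fun x => a x ^ 2 * b x ^ 2) + 3 * σ * expect p (fun x => b x ^ 4) := by
      conv_lhs => rw [hfab]
      rw [expect_add_bit_mul i (fun t => t ^ 4) (update_of_dependsOn haT hi)
        (update_of_dependsOn hbT hi), ← expect_const_mul, ← expect_const_mul, ← expect_add,
        ← expect_add]
      exact expect_mono hp fun x => fourth_moment_le hp _ _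
    have hA := normSq_nonneg hp a
    have hB := normSq_nonneg hp b
    have hκ0 : 0 < κ := by linarith
    have hσ0 : 0 < σ := by linarith
    have hκσ : 4 ≤ κ * σ := by
      rw [hκs, div_mul_eq_mul_div, le_div_iff₀ hs]; linarith
    set P := κ ^ (2 * d) with hP
    have hP0 : 0 < P := by positivity
    have hPd : κ ^ (2 * (d + 1)) = P * κ ^ 2 := by rw [hP]; ring
    rw [hPd] at iha ⊢
    have hmix : expect p (fun x => a x ^ 2 * b x ^ 2) ≤ P * κ * (normSq p a * normSq p b) := by
      refine le_of_sq_le_sq ?_ (by positivity)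
      refine hcs.trans ((mul_le_mul iha ihb (expect_nonneg hp fun x => by positivity)
        (by positivity)).trans_eq ?_)
      ring
    rw [hN]
    have e1 : 8 * σ * expect p (fun x => a x ^ 2 * b x ^ 2) ≤
        8 * σ * (P * κ * (normSq p a * normSq p b)) := by gcongr
    have e2 : 3 * σ * expect p (fun x => b x ^ 4) ≤ 3 * σ * (P * normSq p b ^ 2) := by gcongr
    have e3 : 8 * σ * (P * κ * (normSq p a * normSq p b)) ≤
        P * κ ^ 2 * (2 * σ * (normSq p a * normSq p b)) := by
      have : 0 ≤ P * κ * σ * (normSq p a * normSq p b) := by positivity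
      nlinarith
    have e4 : 3 * σ * (P * normSq p b ^ 2) ≤ P * κ ^ 2 * (σ ^ 2 * normSq p b ^ 2) := by
      have h0 : 0 ≤ P * σ * normSq p b ^ 2 := by positivity
      have : 3 ≤ κ * (κ * σ) := by nlinarith
      nlinarith [mul_le_mul_of_nonneg_left this h0]
    linarith

/-- Hypercontractivity (the Bonami lemma): the fourth moment of a function of bounded degree is
controlled by its second moment, independently of the dimension. -/
lemma expect_pow_four_le (hs : 0 < s) (hsp : s ≤ p * (1 - p)) {f : Cube n → ℝ}
    (hf : DegreeLE d f) :
    expect p (fun x => f x ^ 4) ≤ (4 / s) ^ (2 * d) * normSq p f ^ 2 :=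
  expect_pow_four_le_of_dependsOn hs hsp univ d f hf fun x y h => by
    rw [funext fun i => h i (by simp)]

lemma discreteDeriv_comm_add_bit_mul {i j : Fin n} (hij : j ≠ i) (a b : Cube n → ℝ) (x : Cube n) :
    discreteDeriv j (fun x => a x + (bit x i - p) * b x) x =
      discreteDeriv j a x + (bit x i - p) * discreteDeriv j b x := by
  simp [discreteDeriv, bit, hij.symm]
  ring

lemma discreteDeriv_dependsOn_self {f : Cube n → ℝ} {T : Finset (Fin n)}
    (hf : DependsOn f T) (i : Fin n) : DependsOn (discreteDeriv i f) T :=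
  discreteDeriv_dependsOn fun _ _ h => hf fun j hj => h j (by simpa using Or.inr hj)

/-- The bound on the total influence, by induction on the coordinates that `f` depends on: for
`f = a + (bit i - p) * b`, the squared norms of `f` and of its other derivatives split
orthogonally. -/
lemma sum_influence_le_of_dependsOn (hp : p ∈ Set.Icc (0 : ℝ) 1) (T : Finset (Fin n)) :
    ∀ (d : ℕ) (f : Cube n → ℝ), DegreeLE d f → DependsOn f T →
      p * (1 - p) * ∑ i ∈ T, normSq p (discreteDeriv i f) ≤ d * normSq p f := by
  have hσ : 0 ≤ p * (1 - p) := mul_nonneg hp.1 (by linarith [hp.2])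
  induction T using Finset.induction_on with
  | empty =>
    intro d f _ _
    have := normSq_nonneg hp f
    simp only [sum_empty, mul_zero]
    positivity
  | insert i T hi ih =>
    rintro (_ | d) f hf hfT
    · have (j : Fin n) : discreteDeriv j f = fun _ => 0 :=
        funext fun x => sub_eq_zero.mpr (hf.eq_const _ _)
      simp [this, normSq, expect_const]
    set a := average p {i} f
    set b := discreteDeriv i f
    have haT : DependsOn a T := average_singleton_dependsOn hfT
    have hbT : DependsOn b T := discreteDeriv_dependsOn hfT
    have hfab : f = fun x => a x + (bit x i - p) * b x := funext fun x => eq_average_add i f x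
    have hN : normSq p f = normSq p a + p * (1 - p) * normSq p b := by
      conv_lhs => rw [hfab]
      exact expect_add_bit_mul_sq i (update_of_dependsOn haT hi) (update_of_dependsOn hbT hi)
    have hD : ∀ j ∈ T, normSq p (discreteDeriv j f) =
        normSq p (discreteDeriv j a) + p * (1 - p) * normSq p (discreteDeriv j b) := by
      intro j hj
      have hji : j ≠ i := fun h => hi (h ▸ hj)
      rw [hfab, funext (discreteDeriv_comm_add_bit_mul hji a b)]
      exact expect_add_bit_mul_sq i
        (update_of_dependsOn (discreteDeriv_dependsOn_self haT j) hi)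
        (update_of_dependsOn (discreteDeriv_dependsOn_self hbT j) hi)
    have iha := ih (d + 1) a (hf.average _) haT
    have ihb := ih d b (hf.discreteDeriv_succ i) hbT
    rw [sum_insert hi, sum_congr rfl hD, sum_add_distrib, ← mul_sum, hN]
    have := mul_le_mul_of_nonneg_left ihb hσ
    push_cast at iha ⊢
    linarith

/-- The total influence of a function of degree `d` is at most `d` times its squared norm. -/
lemma sum_influence_le (hp : p ∈ Set.Icc (0 : ℝ) 1) {f : Cube n → ℝ} (hf : DegreeLE d f) :
    p * (1 - p) * ∑ i, normSq p (discreteDeriv i f) ≤ d * normSq p f :=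
  sum_influence_le_of_dependsOn hp univ d f hf fun x y h => by
    rw [funext fun i => h i (by simp)]

/-! ### Dichotomies for functions of bounded degree -/

lemma exists_pos_le_abs (D : Finset ℝ) : ∃ δ > 0, ∀ x ∈ D, x ≠ 0 → δ ≤ |x| := by
  induction D using Finset.induction_on with
  | empty => exact ⟨1, one_pos, by simp⟩
  | insert a D _ ih =>
    obtain ⟨δ, hδ, h⟩ := ih
    by_cases ha : a = 0
    · refine ⟨δ, hδ, fun x hx hx0 => h x ?_ hx0⟩
      rcases mem_insert.mp hx with rfl | hx
      · exact absurd ha hx0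
      · exact hx
    · refine ⟨min δ |a|, lt_min hδ (abs_pos.mpr ha), fun x hx hx0 => ?_⟩
      rcases mem_insert.mp hx with rfl | hx
      · exact min_le_right _ _
      · exact (min_le_left _ _).trans (h x hx hx0)

/-- The set of differences of elements of `A`. -/
noncomputable def differences (A : Finset ℝ) : Finset ℝ := image₂ (fun a b => a - b) A A

lemma sub_mem_differences {A : Finset ℝ} {a b : ℝ} (ha : a ∈ A) (hb : b ∈ A) :
    a - b ∈ differences A :=
  mem_image₂_of_mem ha hb

lemma exists_infDist_eq {A : Finset ℝ} (hA : A.Nonempty) (t : ℝ) :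
    ∃ a ∈ A, Metric.infDist t (A : Set ℝ) = |t - a| :=
  A.finite_toSet.isCompact.exists_infDist_eq_dist hA t

lemma infDist_le_abs {A : Finset ℝ} {a : ℝ} (ha : a ∈ A) (t : ℝ) :
    Metric.infDist t (A : Set ℝ) ≤ |t - a| :=
  Metric.infDist_le_dist_of_mem (mem_coe.mpr ha)

/-- If `t` is closer to `a ∈ A` than half the gap `δ` of `A`, then `a` is the nearest point of
`A`; otherwise the fourth power of `t - a` dominates. -/
lemma sq_sub_le {A : Finset ℝ} {δ : ℝ} (hδ : 0 < δ)
    (hgap : ∀ x ∈ differences A, x ≠ 0 → δ ≤ |x|) {a : ℝ} (ha : a ∈ A) (t : ℝ) :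
    (t - a) ^ 2 ≤ Metric.infDist t (A : Set ℝ) ^ 2 + 4 / δ ^ 2 * (t - a) ^ 4 := by
  obtain ⟨b, hb, hbt⟩ := exists_infDist_eq ⟨a, ha⟩ t
  rw [hbt, sq_abs]
  by_cases hab : a = b
  · subst hab
    have : 0 ≤ 4 / δ ^ 2 * (t - a) ^ 4 := by positivity
    linarith
  have hδab := hgap _ (sub_mem_differences ha hb) (sub_ne_zero.mpr hab)
  have htri : |a - b| ≤ |t - a| + |t - b| := by
    rw [← abs_neg (t - a)]
    exact (abs_add_le _ _).trans' (by rw [neg_sub, sub_add_sub_cancel])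
  rcases le_total |t - a| (δ / 2) with h | h
  · have h1 : (t - a) ^ 2 ≤ (t - b) ^ 2 := sq_le_sq.mpr (by linarith)
    have : 0 ≤ 4 / δ ^ 2 * (t - a) ^ 4 := by positivity
    linarith
  · have h1 : (δ / 2) ^ 2 ≤ (t - a) ^ 2 := by
      rw [← sq_abs (t - a)]; gcongr
    have h2 : (t - a) ^ 2 ≤ 4 / δ ^ 2 * (t - a) ^ 4 := by
      rw [div_mul_eq_mul_div, le_div_iff₀ (by positivity)]
      nlinarith [sq_nonneg (t - a)]
    have := sq_nonneg (t - b)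
    linarith

/-- A function of bounded degree that is close to `A` is either very close to a given point of
`A`, or at a distance bounded below. -/
lemma exists_dichotomy (d : ℕ) (A : Finset ℝ) (hs : 0 < s) :
    ∃ c > 0, ∀ (p : ℝ), s ≤ p * (1 - p) → ∀ (n : ℕ) (f : Cube n → ℝ), DegreeLE d f → ∀ a ∈ A,
      c ≤ normSq p (fun x => f x - a) ∨ normSq p (fun x => f x - a) ≤ 2 * distSq p f A := by
  obtain ⟨δ, hδ, hgap⟩ := exists_pos_le_abs (differences A)
  set L := 4 / δ ^ 2 * (4 / s) ^ (2 * d) with hL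
  have hL0 : 0 < L := by positivity
  refine ⟨1 / (2 * L), by positivity, fun p hsp n f hf a ha => ?_⟩
  have hp := mem_Icc_of_le hs hsp
  rw [or_iff_not_imp_left, not_le]
  intro hlt
  set v := normSq p (fun x => f x - a) with hv
  have h4 := expect_pow_four_le hs hsp (hf.sub (DegreeLE.const a))
  have h2 : v ≤ distSq p f A + 4 / δ ^ 2 * expect p (fun x => (f x - a) ^ 4) := by
    rw [hv, normSq, distSq, ← expect_const_mul, ← expect_add]
    exact expect_mono hp fun x => sq_sub_le hδ hgap ha (f x)
  have h3 : v ≤ distSq p f A + L * v ^ 2 := by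
    refine h2.trans ?_
    rw [hL, mul_assoc]
    gcongr
  have hv0 : 0 ≤ v := normSq_nonneg hp _
  have hLv : L * v ≤ 1 / 2 := by
    rw [lt_div_iff₀ (by positivity)] at hlt
    linarith
  nlinarith

lemma normSq_sub_const (f : Cube n → ℝ) (a : ℝ) :
    normSq p (fun x => f x - a) =
      normSq p (fun x => f x - expect p f) + (expect p f - a) ^ 2 := by
  have h (x : Cube n) : (f x - a) ^ 2 = (f x - expect p f) ^ 2 +
      ((expect p f - a) ^ 2 + 2 * (expect p f - a) * (f x - expect p f)) := by ring
  simp only [normSq, h]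
  rw [expect_add, expect_add, expect_const, expect_const_mul, expect_sub, expect_const]
  ring

/-- The variance of a function of bounded degree that is close to `A` is either very small or
bounded below. -/
lemma exists_variance_dichotomy (d : ℕ) {A : Finset ℝ} (hA : A.Nonempty) (hs : 0 < s) :
    ∃ c > 0, ∀ (p : ℝ), s ≤ p * (1 - p) → ∀ (n : ℕ) (f : Cube n → ℝ), DegreeLE d f →
      c ≤ normSq p (fun x => f x - expect p f) ∨
        normSq p (fun x => f x - expect p f) ≤ 2 * distSq p f A := by
  obtain ⟨c, hc, h⟩ := exists_dichotomy d A hs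
  refine ⟨c / 8, by positivity, fun p hsp n f hf => ?_⟩
  have hp := mem_Icc_of_le hs hsp
  rw [or_iff_not_imp_left, not_le]
  intro hlt
  set μ := expect p f with hμ
  set v := normSq p (fun x => f x - μ) with hv
  have hε := distSq_nonneg hp f A
  by_cases hbig : c / 8 < distSq p f A
  · linarith
  -- the point of `A` nearest to the mean is close to the mean, hence to `f`
  obtain ⟨a, ha, hμa⟩ := exists_infDist_eq hA μ
  have hmean : (μ - a) ^ 2 ≤ 2 * v + 2 * distSq p f A := by
    rw [hv, normSq, distSq, ← expect_const_mul, ← expect_const_mul, ← expect_add,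
      ← expect_const (n := n) (p := p) ((μ - a) ^ 2)]
    refine expect_mono hp fun x => ?_
    have h1 := Metric.infDist_le_infDist_add_dist (s := (A : Set ℝ)) (x := μ) (y := f x)
    rw [hμa, dist_comm, Real.dist_eq] at h1
    rw [← sq_abs (μ - a), ← sq_abs (f x - μ)]
    have h2 := abs_nonneg (μ - a)
    nlinarith [sq_nonneg (Metric.infDist (f x) (A : Set ℝ) - |f x - μ|)]
  have hsum := normSq_sub_const (p := p) f a
  rcases h p hsp n f hf a ha with h | h
  · linarith
  · have := sq_nonneg (μ - a)
    linarith

lemma distSq_piecewise (T : Finset (Fin n)) (f : Cube n → ℝ) (A : Finset ℝ) :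
    expect p (fun x => distSq p (fun y => f (T.piecewise y x)) A) = distSq p f A :=
  expect_expect_piecewise T fun x => Metric.infDist (f x) (A : Set ℝ) ^ 2

/-- The averaged form of the variance dichotomy: the expected conditional variance of `f` given the
coordinates outside `T` is either very small or bounded below. Hypercontractivity of
`f - average p T f` prevents the conditional variance from concentrating on few points. -/
lemma exists_average_dichotomy (d : ℕ) {A : Finset ℝ} (hA : A.Nonempty) (hs : 0 < s) :
    ∃ c > 0, ∀ (p : ℝ), s ≤ p * (1 - p) → ∀ (n : ℕ) (f : Cube n → ℝ), DegreeLE d f →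
      ∀ T : Finset (Fin n), c ≤ normSq p (fun x => f x - average p T f x) ∨
        normSq p (fun x => f x - average p T f x) ≤ 4 * distSq p f A := by
  obtain ⟨c, hc, h⟩ := exists_variance_dichotomy d hA hs
  set K := (4 / s) ^ (2 * d) with hK
  have hK0 : 0 < K := by positivity
  refine ⟨c / (2 * K), by positivity, fun p hsp n f hf T => ?_⟩
  have hp := mem_Icc_of_le hs hsp
  rw [or_iff_not_imp_left, not_le]
  intro hlt
  set g : Cube n → ℝ := fun x => f x - average p T f x with hg
  set W := normSq p g with hW
  -- `V x` is the conditional variance of `f` given the coordinates of `x` outside `T`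
  set V : Cube n → ℝ := fun x => expect p (fun y => g (T.piecewise y x) ^ 2) with hV
  have hVW : expect p V = W := expect_expect_piecewise T fun x => g x ^ 2
  have hV0 (x : Cube n) : 0 ≤ V x := expect_nonneg hp fun y => sq_nonneg _
  have hV2 : expect p (fun x => V x ^ 2) ≤ K * W ^ 2 := by
    refine le_trans ?_ (expect_pow_four_le hs hsp (hf.sub (hf.average T)))
    rw [← expect_expect_piecewise T (fun x => (f x - average p T f x) ^ 4)]
    refine expect_mono hp fun x => (expect_sq_le hp _).trans_eq ?_
    simp only [hg, ← pow_mul]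
  have hpt (x : Cube n) :
      V x ≤ 2 * distSq p (fun y => f (T.piecewise y x)) A + 1 / c * V x ^ 2 := by
    have hVx : V x = normSq p (fun y => f (T.piecewise y x) -
        expect p (fun y => f (T.piecewise y x))) := by
      simp only [hV, hg, average_piecewise]
      rfl
    have hd := distSq_nonneg hp (fun y => f (T.piecewise y x)) A
    rcases h p hsp n _ (hf.piecewise_left T x) with h | h
    · rw [← hVx] at h
      have : V x ≤ 1 / c * V x ^ 2 := by
        rw [div_mul_eq_mul_div, le_div_iff₀ hc]
        nlinarith [hV0 x]
      linarith
    · rw [← hVx] at h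
      have : 0 ≤ 1 / c * V x ^ 2 := by positivity
      linarith
  have hsum := expect_mono hp hpt
  rw [hVW, expect_add, expect_const_mul, expect_const_mul, distSq_piecewise] at hsum
  have hW0 : 0 ≤ W := normSq_nonneg hp _
  have hKW : 1 / c * (K * W ^ 2) ≤ W / 2 := by
    rw [lt_div_iff₀ (by positivity)] at hlt
    rw [div_mul_eq_mul_div, div_le_iff₀ hc]
    nlinarith
  have : 1 / c * expect p (fun x => V x ^ 2) ≤ 1 / c * (K * W ^ 2) := by gcongr
  linarith

/-! ### Approximation by juntas -/

lemma infDist_sub_sq_le {A : Finset ℝ} (hA : A.Nonempty) (t u : ℝ) :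
    Metric.infDist (t - u) (differences A : Set ℝ) ^ 2 ≤
      2 * (Metric.infDist t (A : Set ℝ) ^ 2 + Metric.infDist u (A : Set ℝ) ^ 2) := by
  obtain ⟨a, ha, hta⟩ := exists_infDist_eq hA t
  obtain ⟨b, hb, hub⟩ := exists_infDist_eq hA u
  have h := infDist_le_abs (sub_mem_differences ha hb) (t - u)
  have h' : |t - u - (a - b)| ≤ |t - a| + |u - b| := by
    rw [sub_sub_sub_comm]; exact abs_sub _ _
  rw [hta, hub]
  have h0 := Metric.infDist_nonneg (x := t - u) (s := (differences A : Set ℝ))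
  nlinarith [sq_nonneg (|t - a| - |u - b|)]

lemma distSq_discreteDeriv_le (hs : 0 < s) (hsp : s ≤ p * (1 - p)) {A : Finset ℝ}
    (hA : A.Nonempty) (f : Cube n → ℝ) (i : Fin n) :
    distSq p (discreteDeriv i f) (differences A) ≤ 2 / s * distSq p f A := by
  have hp := mem_Icc_of_le hs hsp
  have h1 : distSq p (discreteDeriv i f) (differences A) ≤
      2 * (expect p (fun x => Metric.infDist (f (update x i true)) (A : Set ℝ) ^ 2) +
        expect p (fun x => Metric.infDist (f (update x i false)) (A : Set ℝ) ^ 2)) := by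
    rw [← expect_add, ← expect_const_mul]
    exact expect_mono hp fun x => infDist_sub_sq_le hA _ _
  refine h1.trans ?_
  rw [div_mul_eq_mul_div, le_div_iff₀ hs, distSq,
    expect_update i fun x => Metric.infDist (f x) (A : Set ℝ) ^ 2]
  have e1 : 0 ≤ expect p (fun x => Metric.infDist (f (update x i true)) (A : Set ℝ) ^ 2) :=
    expect_nonneg hp fun x => sq_nonneg _
  have e2 : 0 ≤ expect p (fun x => Metric.infDist (f (update x i false)) (A : Set ℝ) ^ 2) :=
    expect_nonneg hp fun x => sq_nonneg _
  have s1 : s ≤ p := by nlinarith [hp.1]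
  have s2 : s ≤ 1 - p := by nlinarith [hp.2]
  nlinarith [mul_le_mul_of_nonneg_right s1 e1, mul_le_mul_of_nonneg_right s2 e2]

/-- The influences of a function of bounded degree that is close to `A` are either very small or
bounded below. -/
lemma exists_influence_dichotomy (d : ℕ) {A : Finset ℝ} (hA : A.Nonempty) (hs : 0 < s) :
    ∃ c > 0, ∀ (p : ℝ), s ≤ p * (1 - p) → ∀ (n : ℕ) (f : Cube n → ℝ), DegreeLE d f → ∀ i,
      c ≤ normSq p (discreteDeriv i f) ∨
        normSq p (discreteDeriv i f) ≤ 4 / s * distSq p f A := by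
  obtain ⟨c, hc, h⟩ := exists_dichotomy d (differences A) hs
  refine ⟨c, hc, fun p hsp n f hf i => ?_⟩
  obtain ⟨a, ha⟩ := hA
  have h0 : (0 : ℝ) ∈ differences A := by simpa using sub_mem_differences ha ha
  have := h p hsp n _ (hf.discreteDeriv i) 0 h0
  simp only [sub_zero] at this
  refine this.imp_right fun h' => h'.trans ?_
  have := distSq_discreteDeriv_le hs hsp ⟨a, ha⟩ f i
  calc _ ≤ 2 * (2 / s * distSq p f A) := by gcongr
    _ = _ := by ring

lemma exists_normSq_le (A : Finset ℝ) (hA : A.Nonempty) :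
    ∃ R ≥ 0, ∀ p ∈ Set.Icc (0 : ℝ) 1, ∀ (n : ℕ) (f : Cube n → ℝ),
      normSq p f ≤ 2 * distSq p f A + R := by
  obtain ⟨R, hR⟩ := (A.image fun a => a ^ 2).exists_le
  refine ⟨2 * max R 0, by positivity, fun p hp n f => ?_⟩
  rw [normSq, distSq, ← expect_const_mul, ← expect_const (n := n) (p := p) (2 * max R 0),
    ← expect_add]
  refine expect_mono hp fun x => ?_
  obtain ⟨a, ha, h⟩ := exists_infDist_eq hA (f x)
  have h2 : a ^ 2 ≤ max R 0 := (hR _ (mem_image_of_mem _ ha)).trans (le_max_left _ _)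
  rw [h, sq_abs]
  nlinarith [sq_nonneg (f x - 2 * a)]

/-- The number of influential coordinates is bounded. -/
lemma exists_card_influential_le (d : ℕ) {A : Finset ℝ} (hA : A.Nonempty) (hs : 0 < s) {c : ℝ}
    (hc : 0 < c) :
    ∃ N : ℕ, ∀ (p : ℝ), s ≤ p * (1 - p) → ∀ (n : ℕ) (f : Cube n → ℝ), DegreeLE d f →
      distSq p f A ≤ 1 → (univ.filter fun i => c ≤ normSq p (discreteDeriv i f)).card ≤ N := by
  obtain ⟨R, hR, h⟩ := exists_normSq_le A hA
  obtain ⟨N, hN⟩ := exists_nat_ge (d * (2 + R) / (s * c))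
  refine ⟨N, fun p hsp n f hf hε => ?_⟩
  have hp := mem_Icc_of_le hs hsp
  set J := univ.filter fun i => c ≤ normSq p (discreteDeriv i f) with hJ
  have h1 : (J.card : ℝ) * c ≤ ∑ i, normSq p (discreteDeriv i f) := by
    rw [← nsmul_eq_mul, ← sum_const]
    refine (sum_le_sum fun i hi => (mem_filter.mp hi).2).trans ?_
    exact sum_le_sum_of_subset_of_nonneg (subset_univ _) fun i _ _ => normSq_nonneg hp _
  have h2 := sum_influence_le hp hf
  have h3 : (d : ℝ) * normSq p f ≤ d * (2 + R) := by
    have := h p hp n f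
    gcongr
    linarith
  have h4 : (J.card : ℝ) * (s * c) ≤ d * (2 + R) := by
    have h5 : 0 ≤ ∑ i, normSq p (discreteDeriv i f) := sum_nonneg fun i _ => normSq_nonneg hp _
    nlinarith [mul_le_mul_of_nonneg_right hsp h5]
  have h5 : (J.card : ℝ) ≤ N := by
    refine le_trans ?_ hN
    rwa [le_div_iff₀ (by positivity)]
  exact_mod_cast h5

/-- A function of degree `d` that is sufficiently close to `A` is approximated, with a linear loss,
by its average over all coordinates outside a bounded set `J` of influential coordinates. The
coordinates outside `J` are averaged out one at a time; as each step changes the error only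
slightly, the error cannot jump over the gap in `exists_average_dichotomy`. -/
lemma exists_junta_approx (d : ℕ) {A : Finset ℝ} (hA : A.Nonempty) (hs : 0 < s) :
    ∃ ε₀ > 0, ∃ N : ℕ, ∀ (p : ℝ), s ≤ p * (1 - p) → ∀ (n : ℕ) (f : Cube n → ℝ), DegreeLE d f →
      distSq p f A ≤ ε₀ → ∃ J : Finset (Fin n), J.card ≤ N ∧
        normSq p (fun x => f x - average p Jᶜ f x) ≤ 4 * distSq p f A := by
  obtain ⟨c, hc, hW⟩ := exists_average_dichotomy d hA hs
  obtain ⟨c', hc', hI⟩ := exists_influence_dichotomy d hA hs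
  obtain ⟨N, hN⟩ := exists_card_influential_le d hA hs hc'
  refine ⟨min 1 (c / (2 * (8 + 8 / s))), by positivity, N, fun p hsp n f hf hε => ?_⟩
  have hp := mem_Icc_of_le hs hsp
  refine ⟨_, hN p hsp n f hf (hε.trans (min_le_left _ _)), ?_⟩
  set J := univ.filter fun i => c' ≤ normSq p (discreteDeriv i f) with hJ
  have hε0 := distSq_nonneg hp f A
  have hε' : (8 + 8 / s) * distSq p f A < c := by
    have := hε.trans (min_le_right _ _)
    rw [le_div_iff₀ (by positivity)] at this
    linarith
  suffices H : ∀ T : Finset (Fin n), T ⊆ Jᶜ →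
      normSq p (fun x => f x - average p T f x) ≤ 4 * distSq p f A from H _ subset_rfl
  intro T
  induction T using Finset.induction_on with
  | empty =>
    intro _
    have h0 : normSq p (fun x => f x - average p ∅ f x) = 0 := by
      simp [average, normSq, expect_const]
    rw [h0]
    positivity
  | insert i T hi ih =>
    intro hT
    have ih' := ih ((subset_insert i T).trans hT)
    have hiJ : normSq p (discreteDeriv i f) ≤ 4 / s * distSq p f A := by
      refine (hI p hsp n f hf i).resolve_left fun h => ?_
      have := hT (mem_insert_self i T)
      rw [mem_compl, hJ, mem_filter] at this
      exact this ⟨mem_univ i, h⟩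
    refine (hW p hsp n f hf (insert i T)).resolve_left (not_le.mpr ?_)
    have hsplit : (fun x => f x - average p (insert i T) f x) = fun x =>
        (f x - average p T f x) + average p T (fun y => f y - average p {i} f y) x := by
      ext x
      rw [average_insert hi, average_sub]
      ring
    rw [hsplit]
    refine (normSq_add_le hp _ _).trans_lt ?_
    have h1 := (normSq_average_le hp T (fun y => f y - average p {i} f y)).trans
      (normSq_sub_average_singleton_le hp i f)
    have h2 : (8 + 8 / s) * distSq p f A =
      2 * (4 * distSq p f A) + 2 * (4 / s * distSq p f A) := by ring
    linarith

/-! ### Möbius coefficients -/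

/-- The indicator of `T`, as a point of the cube. -/
def indicator (T : Finset (Fin n)) : Cube n := fun i => decide (i ∈ T)

/-- The coefficient of `monomial S` in the multilinear expansion of `f`, given by Möbius
inversion. -/
def mobiusCoeff (f : Cube n → ℝ) (S : Finset (Fin n)) : ℝ :=
  ∑ T ∈ S.powerset, (-1) ^ (S \ T).card * f (indicator T)

lemma monomial_indicator (R T : Finset (Fin n)) :
    monomial R (indicator T) = if R ⊆ T then 1 else 0 := by
  simp only [monomial, bit, indicator, decide_eq_true_eq]
  split_ifs with h
  · exact prod_eq_one fun i hi => if_pos (h hi)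
  · obtain ⟨i, hi, hiT⟩ := not_subset.mp h
    exact prod_eq_zero hi (if_neg hiT)

lemma mobiusCoeff_monomial (R S : Finset (Fin n)) :
    mobiusCoeff (monomial R) S = if R = S then 1 else 0 := by
  simp only [mobiusCoeff, monomial_indicator]
  by_cases hRS : R ⊆ S
  · have h1 := prod_add (fun _ : Fin n => (1 : ℝ)) (fun i => if i ∈ R then 0 else -1) S
    have h2 : ∀ T ∈ S.powerset, (∏ i ∈ T, (1 : ℝ)) * ∏ i ∈ S \ T, (if i ∈ R then (0 : ℝ) else -1)
        = (-1) ^ (S \ T).card * if R ⊆ T then 1 else 0 := by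
      intro T _
      rw [prod_const_one, one_mul]
      split_ifs with h
      · rw [mul_one, ← prod_const]
        exact prod_congr rfl fun i hi => if_neg fun hiR => (mem_sdiff.mp hi).2 (h hiR)
      · obtain ⟨i, hi, hiT⟩ := not_subset.mp h
        rw [mul_zero]
        exact prod_eq_zero (mem_sdiff.mpr ⟨hRS hi, hiT⟩) (if_pos hi)
    rw [← sum_congr rfl h2, ← h1]
    split_ifs with h
    · subst h
      exact prod_eq_one fun i hi => by simp [hi]
    · obtain ⟨i, hi, hiR⟩ := not_subset.mp fun h' => h (hRS.antisymm h')
      exact prod_eq_zero hi (by simp [hiR])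
  · rw [if_neg fun h => hRS h.subset]
    refine sum_eq_zero fun T hT => ?_
    rw [if_neg fun h => hRS (h.trans (mem_powerset.mp hT)), mul_zero]

lemma mobiusCoeff_of_expansion {f : Cube n → ℝ} {c : Finset (Fin n) → ℝ}
    (hf : ∀ x, f x = ∑ S, c S * monomial S x) (S : Finset (Fin n)) : mobiusCoeff f S = c S := by
  have h : mobiusCoeff f S = ∑ R, c R * mobiusCoeff (monomial R) S := by
    simp only [mobiusCoeff, hf, mul_sum]
    rw [sum_comm]
    exact sum_congr rfl fun R _ => sum_congr rfl fun T _ => by ring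
  simp [h, mobiusCoeff_monomial]

lemma DegreeLE.mobiusCoeff_eq_zero {f : Cube n → ℝ} (hf : DegreeLE d f) {S : Finset (Fin n)}
    (hS : d < S.card) : mobiusCoeff f S = 0 := by
  obtain ⟨c, hc, hf⟩ := hf
  rw [mobiusCoeff_of_expansion hf, hc S hS]

/-- Möbius inversion: the monomials are linearly independent, hence a basis by a dimension
count. -/
lemma eq_sum_mobiusCoeff (f : Cube n → ℝ) (x : Cube n) :
    f x = ∑ S, mobiusCoeff f S * monomial S x := by
  let Φ : (Finset (Fin n) → ℝ) →ₗ[ℝ] (Cube n → ℝ) :=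
    Fintype.linearCombination ℝ (fun S : Finset (Fin n) => (monomial S : Cube n → ℝ))
  have hΦ (c : Finset (Fin n) → ℝ) (x : Cube n) : Φ c x = ∑ S, c S * monomial S x := by
    simp [Φ, Fintype.linearCombination_apply]
  have hinj : Injective Φ := fun b c h => funext fun S => by
    rw [← mobiusCoeff_of_expansion (hΦ b) S, h, mobiusCoeff_of_expansion (hΦ c) S]
  have hsurj : Surjective Φ :=
    (LinearMap.injective_iff_surjective_of_finrank_eq_finrank (by simp)).mp hinj
  obtain ⟨c, rfl⟩ := hsurj f
  rw [hΦ]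
  exact sum_congr rfl fun S _ => by rw [mobiusCoeff_of_expansion (hΦ c)]

/-- The expansion of a junta involves only subsets of its set of coordinates. -/
lemma eq_sum_powerset_mobiusCoeff {f : Cube n → ℝ} {J : Finset (Fin n)} (hf : DependsOn f J)
    (x : Cube n) : f x = ∑ S ∈ J.powerset, mobiusCoeff f S * monomial S x := by
  have h : f x = f (J.piecewise x fun _ => false) := hf fun i hi => by
    rw [piecewise_eq_of_mem _ _ _ (mem_coe.mp hi)]
  rw [h, eq_sum_mobiusCoeff f, ← sum_subset (subset_univ J.powerset)]
  · refine sum_congr rfl fun S hS => ?_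
    rw [monomial_piecewise, inter_eq_left.mpr (mem_powerset.mp hS),
      sdiff_eq_empty_iff_subset.mpr (mem_powerset.mp hS)]
    simp [monomial]
  · intro S _ hS
    obtain ⟨i, hi, hiJ⟩ := not_subset.mp fun h => hS (mem_powerset.mpr h)
    have : monomial (S \ J) (fun _ : Fin n => false) = 0 :=
      prod_eq_zero (mem_sdiff.mpr ⟨hi, hiJ⟩) (by simp [bit])
    rw [monomial_piecewise, this, mul_zero, mul_zero]

/-! ### Finiteness of the set of coefficients -/

/-- Products of at most `N` factors from a finite set take finitely many values; additively, so do
sums of at most `N` terms. -/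
@[to_additive]
lemma exists_finset_prod_mem {M : Type*} [CommMonoid M] [DecidableEq M] (A : Finset M) (N : ℕ) :
    ∃ B : Finset M, ∀ {ι : Type} (t : Finset ι) (v : ι → M), t.card ≤ N → (∀ i ∈ t, v i ∈ A) →
      ∏ i ∈ t, v i ∈ B := by
  classical
  induction N with
  | zero =>
    refine ⟨{1}, fun t v ht _ => ?_⟩
    rw [card_eq_zero.mp (Nat.le_zero.mp ht)]
    simp
  | succ N ih =>
    obtain ⟨B, hB⟩ := ih
    refine ⟨insert 1 (image₂ (fun a b => a * b) A B), fun t v ht hv => ?_⟩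
    rcases t.eq_empty_or_nonempty with rfl | ⟨i, hi⟩
    · simp
    · rw [← mul_prod_erase t v hi]
      refine mem_insert_of_mem (mem_image₂_of_mem (hv i hi) (hB _ _ ?_ ?_))
      · rw [card_erase_of_mem hi]; omega
      · exact fun j hj => hv j (mem_of_mem_erase hj)

lemma exists_mobiusCoeff_mem (A : Finset ℝ) (N : ℕ) :
    ∃ D : Finset ℝ, ∀ (n : ℕ) (g : Cube n → ℝ), ValuedIn A g → ∀ S : Finset (Fin n), S.card ≤ N →
      mobiusCoeff g S ∈ D := by
  obtain ⟨D, hD⟩ := exists_finset_sum_mem (A ∪ A.image fun a => -a) (2 ^ N)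
  refine ⟨D, fun n g hg S hS => hD _ _ ?_ fun T _ => ?_⟩
  · rw [card_powerset]
    exact Nat.pow_le_pow_right two_pos hS
  · rcases neg_one_pow_eq_or ℝ (S \ T).card with h | h <;> rw [h]
    · simpa using Or.inl (hg _)
    · simpa using Or.inr (hg _)

/-- The Fourier coefficients of a monomial of degree at most `N` take finitely many values: each
coordinate of the monomial contributes one of two factors. -/
lemma exists_fourierCoeff_monomial_mem (p : ℝ) (N : ℕ) :
    ∃ Y : Finset ℝ, ∀ (n : ℕ) (T S : Finset (Fin n)), T.card ≤ N →
      fourierCoeff p (monomial T) S ∈ Y := by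
  obtain ⟨Y, hY⟩ := exists_finset_prod_mem ({p, p * ((p - 1) / √(p * (1 - p)))} : Finset ℝ) N
  refine ⟨insert 0 Y, fun n T S hT => ?_⟩
  set φ : Fin n → Bool → ℝ := fun i b => (if i ∈ T then if b then 1 else 0 else 1) *
    (if i ∈ S then (p - if b then 1 else 0) / √(p * (1 - p)) else 1) with hφ
  have h1 : fourierCoeff p (monomial T) S = ∏ i, (p * φ i true + (1 - p) * φ i false) := by
    rw [← expect_prod, fourierCoeff]
    congr 1
    ext x
    simp only [hφ, monomial, character, prod_mul_distrib, prod_ite_mem, univ_inter, bit]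
  have hT' : ∀ i ∈ T, p * φ i true + (1 - p) * φ i false ∈
      ({p, p * ((p - 1) / √(p * (1 - p)))} : Finset ℝ) := by
    intro i hi
    by_cases hiS : i ∈ S <;> simp [hφ, hi, hiS]
  by_cases hST : S ⊆ T
  · have h2 : ∏ i, (p * φ i true + (1 - p) * φ i false) =
        ∏ i ∈ T, (p * φ i true + (1 - p) * φ i false) := by
      refine (prod_subset (subset_univ T) fun i _ hi => ?_).symm
      have hiS : i ∉ S := fun h => hi (hST h)
      simp [hφ, hi, hiS]
    rw [h1, h2]
    exact mem_insert_of_mem (hY T _ hT hT')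
  · obtain ⟨i, hiS, hiT⟩ := not_subset.mp hST
    have h0 : p * φ i true + (1 - p) * φ i false = 0 := by
      simp [hφ, hiT, hiS]; ring
    rw [h1, prod_eq_zero (mem_univ i) h0]
    exact mem_insert_self _ _

lemma exists_fourierCoeff_mem (A : Finset ℝ) (N : ℕ) (p : ℝ) :
    ∃ B : Finset ℝ, ∀ (n : ℕ) (g : Cube n → ℝ), ValuedIn A g → ∀ J : Finset (Fin n), J.card ≤ N →
      DependsOn g J → ∀ S, fourierCoeff p g S ∈ B := by
  obtain ⟨D, hD⟩ := exists_mobiusCoeff_mem A N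
  obtain ⟨Y, hY⟩ := exists_fourierCoeff_monomial_mem p N
  obtain ⟨B, hB⟩ := exists_finset_sum_mem (image₂ (fun a b => a * b) D Y) (2 ^ N)
  refine ⟨B, fun n g hg J hJ hgJ S => ?_⟩
  have h : fourierCoeff p g S =
      ∑ T ∈ J.powerset, mobiusCoeff g T * fourierCoeff p (monomial T) S := by
    simp only [fourierCoeff]
    conv_lhs => enter [2, x]; rw [eq_sum_powerset_mobiusCoeff hgJ x, sum_mul]
    rw [expect_sum]
    refine sum_congr rfl fun T _ => ?_
    rw [← expect_const_mul]
    simp only [mul_assoc]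
  rw [h]
  refine hB _ _ ?_ fun T hT => ?_
  · rw [card_powerset]
    exact Nat.pow_le_pow_right two_pos hJ
  · have hTN := (card_le_card (mem_powerset.mp hT)).trans hJ
    exact mem_image₂_of_mem (hD n g hg T hTN) (hY n T S hTN)

/-! ### Rounding -/

lemma pow_card_mul_sq_le_normSq (hs : 0 < s) (hsp : s ≤ p * (1 - p)) {f : Cube n → ℝ}
    {J : Finset (Fin n)} (hf : DependsOn f J) (x : Cube n) :
    s ^ J.card * f x ^ 2 ≤ normSq p f := by
  have hp := mem_Icc_of_le hs hsp
  -- the probability of the event that a random point agrees with `x` on `J`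
  have h1 := expect_prod (p := p) fun (i : Fin n) b => if i ∈ J then if b = x i then 1 else 0 else 1
  have h2 : s ^ J.card ≤ ∏ i, (p * (if i ∈ J then if true = x i then 1 else 0 else 1) +
      (1 - p) * (if i ∈ J then if false = x i then 1 else 0 else 1)) := by
    calc s ^ J.card = ∏ i, if i ∈ J then s else 1 := by simp
      _ ≤ _ := by
        refine prod_le_prod (fun i _ => by split_ifs <;> linarith) fun i _ => ?_
        by_cases hi : i ∈ J
        · cases hx : x i <;> simp [hi] <;> nlinarith [hp.1, hp.2]
        · simp [hi]
  have h3 : expect p (fun y => f x ^ 2 *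
      ∏ i, (if i ∈ J then if y i = x i then (1 : ℝ) else 0 else 1)) ≤ normSq p f := by
    refine expect_mono hp fun y => ?_
    by_cases hxy : ∀ i ∈ J, y i = x i
    · rw [hf (x := x) (y := y) fun i hi => (hxy i hi).symm]
      refine mul_le_of_le_one_right (sq_nonneg _) (prod_le_one (fun i _ => ?_) fun i _ => ?_) <;>
        split_ifs <;> norm_num
    · push Not at hxy
      obtain ⟨i, hi, hne⟩ := hxy
      rw [prod_eq_zero (mem_univ i) (by simp [hi, hne]), mul_zero]
      positivity
  rw [expect_const_mul, h1] at h3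
  refine le_trans ?_ h3
  rw [mul_comm]
  gcongr

/-- An `A`-valued junta that is sufficiently close to a junta of degree at most `d` on the same
coordinates has degree at most `d` itself, since its Möbius coefficients form a discrete set. -/
lemma exists_degreeLE_of_close (d : ℕ) (A : Finset ℝ) (N : ℕ) (hs : 0 < s) :
    ∃ η > 0, ∀ p : ℝ, s ≤ p * (1 - p) → ∀ (n : ℕ) (f g : Cube n → ℝ) (J : Finset (Fin n)),
      J.card ≤ N → DependsOn f J → DependsOn g J → DegreeLE d f → ValuedIn A g →
      normSq p (fun x => f x - g x) ≤ η → DegreeLE d g := by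
  obtain ⟨D, hD⟩ := exists_mobiusCoeff_mem A N
  obtain ⟨δ, hδ, hgap⟩ := exists_pos_le_abs D
  refine ⟨s ^ N * (δ / 2 ^ (N + 1)) ^ 2, by positivity,
    fun p hsp n f g J hJ hfJ hgJ hf hg hclose => ?_⟩
  have hp := mem_Icc_of_le hs hsp
  have hs1 : s ≤ 1 := by nlinarith [hp.1, hp.2]
  have hu : DependsOn (fun x => f x - g x) J := fun x y h => by
    simp only [hfJ h, hgJ h]
  have hpt (x : Cube n) : |f x - g x| ≤ δ / 2 ^ (N + 1) := by
    have h1 := (pow_card_mul_sq_le_normSq hs hsp hu x).trans hclose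
    have h2 : s ^ N ≤ s ^ J.card := pow_le_pow_of_le_one hs.le hs1 hJ
    have h3 : s ^ N * (f x - g x) ^ 2 ≤ s ^ N * (δ / 2 ^ (N + 1)) ^ 2 :=
      (mul_le_mul_of_nonneg_right h2 (sq_nonneg _)).trans h1
    exact abs_le_of_sq_le_sq (le_of_mul_le_mul_left h3 (by positivity)) (by positivity)
  have hzero : ∀ S ∈ J.powerset, d < S.card → mobiusCoeff g S = 0 := by
    intro S hS hSd
    have hSN := (card_le_card (mem_powerset.mp hS)).trans hJ
    by_contra hne
    have hbig := hgap _ (hD n g hg S hSN) hne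
    have hsmall : |mobiusCoeff f S - mobiusCoeff g S| ≤ δ / 2 := by
      simp only [mobiusCoeff, ← sum_sub_distrib, ← mul_sub]
      refine (abs_sum_le_sum_abs _ _).trans ((sum_le_card_nsmul _ _ (δ / 2 ^ (N + 1)) ?_).trans ?_)
      · intro T _
        rw [abs_mul, abs_pow, abs_neg, abs_one, one_pow, one_mul]
        exact hpt _
      · rw [card_powerset, nsmul_eq_mul]
        push_cast
        have : (2 : ℝ) ^ S.card ≤ 2 ^ N := pow_le_pow_right₀ one_le_two hSN
        calc (2 : ℝ) ^ S.card * (δ / 2 ^ (N + 1)) ≤ 2 ^ N * (δ / 2 ^ (N + 1)) := by gcongr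
          _ = δ / 2 := by rw [pow_succ]; field_simp
    rw [hf.mobiusCoeff_eq_zero hSd, zero_sub, abs_neg] at hsmall
    linarith
  have hg' : g = fun x => ∑ S ∈ J.powerset, mobiusCoeff g S * monomial S x :=
    funext (eq_sum_powerset_mobiusCoeff hgJ)
  rw [hg']
  refine DegreeLE.sum _ fun S hS => ?_
  by_cases hSd : S.card ≤ d
  · exact (DegreeLE.monomial hSd).const_mul _
  · simpa [hzero S hS (not_le.mp hSd)] using DegreeLE.const 0

lemma average_compl_dependsOn (J : Finset (Fin n)) (f : Cube n → ℝ) :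
    DependsOn (average p Jᶜ f) J := by
  intro x y h
  have (z : Cube n) : Jᶜ.piecewise z x = Jᶜ.piecewise z y := by
    ext i
    by_cases hi : i ∈ J
    · simpa [hi] using h i hi
    · simp [hi]
  simp only [average, this]

/-- The approximation theorem, with a constant that is uniform for `p` in a compact subset of
`(0, 1)`. -/
lemma exists_approx (d : ℕ) {A : Finset ℝ} (hA : A.Nonempty) (hs : 0 < s) :
    ∃ C : ℝ, ∀ p : ℝ, s ≤ p * (1 - p) → ∀ (n : ℕ) (f : Cube n → ℝ), DegreeLE d f →
      ∃ g : Cube n → ℝ, DegreeLE d g ∧ ValuedIn A g ∧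
        normSq p (fun x => f x - g x) ≤ C * distSq p f A := by
  obtain ⟨ε₀, hε₀, N, hJ⟩ := exists_junta_approx d hA hs
  obtain ⟨η, hη, hround⟩ := exists_degreeLE_of_close d A N hs
  obtain ⟨R, hR, hnorm⟩ := exists_normSq_le A hA
  obtain ⟨a, ha⟩ := hA
  set ε₁ := min ε₀ (η / 10) with hε₁
  have hε₁0 : 0 < ε₁ := by positivity
  set Q := (2 * R + 2 * a ^ 2) / ε₁ with hQ
  have hQ0 : 0 ≤ Q := by positivity
  -- for small `ε` the error is at most `2 * 4ε + 2 * 10ε`, through the average `m`; for large `ε`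
  -- the constant function `a` has error at most `4ε + Q * ε`
  refine ⟨28 + Q, fun p hsp n f hf => ?_⟩
  have hp := mem_Icc_of_le hs hsp
  have hε := distSq_nonneg hp f A
  rcases le_or_gt (distSq p f A) ε₁ with hsmall | hlarge
  · obtain ⟨J, hJN, hfJ⟩ := hJ p hsp n f hf (hsmall.trans (min_le_left _ _))
    set m := average p Jᶜ f with hm
    choose r hrA hr using exists_infDist_eq (A := A) ⟨a, ha⟩
    have hmg : normSq p (fun x => m x - r (m x)) ≤ 10 * distSq p f A := by
      have h1 : normSq p (fun x => m x - r (m x)) ≤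
          2 * normSq p (fun x => f x - m x) + 2 * distSq p f A := by
        rw [normSq, normSq, distSq, ← expect_const_mul, ← expect_const_mul, ← expect_add]
        refine expect_mono hp fun x => ?_
        have h2 := Metric.infDist_le_infDist_add_dist (s := (A : Set ℝ)) (x := m x) (y := f x)
        rw [hr (m x), dist_comm, Real.dist_eq] at h2
        rw [← sq_abs (m x - r (m x)), ← sq_abs (f x - m x)]
        have h3 := abs_nonneg (m x - r (m x))
        nlinarith [sq_nonneg (Metric.infDist (f x) (A : Set ℝ) - |f x - m x|)]
      linarith
    refine ⟨fun x => r (m x), ?_, fun x => hrA _, ?_⟩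
    · have hmJ : DependsOn m J := average_compl_dependsOn J f
      refine hround p hsp n m _ J hJN hmJ (fun x y h => ?_) (hf.average _) (fun x => hrA _) ?_
      · simp only [hmJ h]
      · have := hsmall.trans (min_le_right _ _)
        linarith
    · have h1 := normSq_add_le hp (fun x => f x - m x) (fun x => m x - r (m x))
      simp only [sub_add_sub_cancel] at h1
      nlinarith
  · refine ⟨fun _ => a, DegreeLE.const a, fun _ => ha, ?_⟩
    have h1 := normSq_add_le hp f (fun _ => -a)
    simp only [← sub_eq_add_neg] at h1
    have h2 : normSq p (fun _ : Cube n => -a) = a ^ 2 := by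
      rw [normSq, expect_const, neg_sq]
    have h3 := hnorm p hp n f
    have h4 : 2 * R + 2 * a ^ 2 ≤ Q * distSq p f A := by
      rw [hQ, div_mul_eq_mul_div, le_div_iff₀ hε₁0]
      gcongr
    linarith

/-! ### Juntas -/

lemma normSq_eq_zero (hp : p ∈ Set.Ioo (0 : ℝ) 1) {f : Cube n → ℝ} (h : normSq p f ≤ 0)
    (x : Cube n) : f x = 0 := by
  have hw : 0 < weight p x := prod_pos fun i _ => by
    split_ifs
    · exact hp.1
    · linarith [hp.2]
  have h1 : weight p x * f x ^ 2 ≤ normSq p f :=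
    single_le_sum (f := fun x => weight p x * f x ^ 2)
      (fun y _ => mul_nonneg (weight_nonneg ⟨hp.1.le, hp.2.le⟩ y) (sq_nonneg _)) (mem_univ x)
  by_contra hne
  have : 0 < weight p x * f x ^ 2 := by positivity
  linarith

lemma dependsOn_of_discreteDeriv_eq_zero {f : Cube n → ℝ} {J : Finset (Fin n)}
    (h : ∀ i ∉ J, ∀ x, discreteDeriv i f x = 0) : DependsOn f J := by
  intro x y hxy
  suffices H : ∀ T : Finset (Fin n), T ⊆ Jᶜ → f (T.piecewise y x) = f x by
    rw [← H _ subset_rfl]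
    congr 1
    ext i
    by_cases hi : i ∈ J
    · simpa [hi] using hxy i hi
    · simp [hi]
  intro T
  induction T using Finset.induction_on with
  | empty => simp
  | insert i T hi ih =>
    intro hT
    rw [← ih ((subset_insert i T).trans hT), piecewise_insert]
    have hiJ := h i (mem_compl.mp (hT (mem_insert_self i T))) (T.piecewise y x)
    have hb (b c : Bool) : f (update (T.piecewise y x) i b) = f (update (T.piecewise y x) i c) := by
      cases b <;> cases c <;> simp only [sub_eq_zero.mp hiJ]
    rw [hb _ (T.piecewise y x i), update_eq_self]

lemma ValuedIn.distSq_eq_zero {A : Finset ℝ} {g : Cube n → ℝ} (hg : ValuedIn A g) :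
    distSq p g A = 0 := by
  have (x : Cube n) : Metric.infDist (g x) (A : Set ℝ) = 0 :=
    Metric.infDist_zero_of_mem (mem_coe.mpr (hg x))
  simp [distSq, this, expect_const]

/-- An `A`-valued function of bounded degree is a junta: its derivatives take values in the
discrete set of differences, hence nonzero influences are bounded below, while the total influence
is bounded above. -/
lemma exists_dependsOn (d : ℕ) {A : Finset ℝ} (hA : A.Nonempty) :
    ∃ M : ℕ, ∀ (n : ℕ) (g : Cube n → ℝ), DegreeLE d g → ValuedIn A g →
      ∃ J : Finset (Fin n), J.card ≤ M ∧ DependsOn g J := by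
  have hs : (0 : ℝ) < 1 / 4 := by norm_num
  have hsp : (1 / 4 : ℝ) ≤ 1 / 2 * (1 - 1 / 2) := by norm_num
  obtain ⟨c, hc, hI⟩ := exists_influence_dichotomy d hA hs
  obtain ⟨M, hM⟩ := exists_card_influential_le d hA hs hc
  refine ⟨M, fun n g hg hgA => ⟨_, hM _ hsp n g hg ?_, ?_⟩⟩
  · rw [hgA.distSq_eq_zero]
    exact zero_le_one
  · refine dependsOn_of_discreteDeriv_eq_zero fun i hi => ?_
    refine normSq_eq_zero (p := 1 / 2) ⟨by norm_num, by norm_num⟩ ?_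
    have := (hI _ hsp n g hg i).resolve_left fun h => hi (mem_filter.mpr ⟨mem_univ i, h⟩)
    rwa [hgA.distSq_eq_zero, mul_zero] at this

/-! ### The Fourier expansion -/

lemma sum_character_mul (hp : p ∈ Set.Ioo (0 : ℝ) 1) (x y : Cube n) :
    weight p y * ∑ S, character p S y * character p S x = if y = x then 1 else 0 := by
  have h0 : p ≠ 0 := hp.1.ne'
  have h1 : 1 - p ≠ 0 := (sub_pos.mpr hp.2).ne'
  have hsq : √(p * (1 - p)) * √(p * (1 - p)) = p * (1 - p) :=
    Real.mul_self_sqrt (mul_nonneg hp.1.le (sub_pos.mpr hp.2).le)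
  have hsum : ∑ S, character p S y * character p S x =
      ∏ i, (1 + (p - bit y i) / √(p * (1 - p)) * ((p - bit x i) / √(p * (1 - p)))) := by
    rw [prod_one_add, powerset_univ]
    simp only [character, prod_mul_distrib]
  rw [hsum, weight, ← prod_mul_distrib]
  simp only [div_mul_div_comm, hsq]
  split_ifs with h
  · subst h
    refine prod_eq_one fun i _ => ?_
    cases hy : y i
    · simp only [bit, hy, Bool.false_eq_true, if_false, sub_zero]
      field_simp
      ring
    · simp only [bit, hy, if_true]
      field_simp
      ring
  · obtain ⟨i, hi⟩ := Function.ne_iff.mp h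
    have hbit : (p - bit y i) * (p - bit x i) = -(p * (1 - p)) := by
      cases hx : x i <;> cases hy : y i <;> simp [hx, hy, bit] at hi ⊢ <;> ring
    refine prod_eq_zero (mem_univ i) (mul_eq_zero_of_right _ ?_)
    rw [hbit, neg_div, div_self (mul_ne_zero h0 h1), add_neg_cancel]

lemma eq_sum_fourierCoeff (hp : p ∈ Set.Ioo (0 : ℝ) 1) (f : Cube n → ℝ) (x : Cube n) :
    f x = ∑ S, fourierCoeff p f S * character p S x := by
  have h : ∑ S, fourierCoeff p f S * character p S x =
      ∑ y, f y * (weight p y * ∑ S, character p S y * character p S x) := by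
    simp only [fourierCoeff, expect, sum_mul, mul_sum]
    rw [sum_comm]
    exact sum_congr rfl fun y _ => sum_congr rfl fun S _ => by ring
  rw [h]
  simp [sum_character_mul hp]

lemma DegreeLE.character {S : Finset (Fin n)} (hS : S.card ≤ d) :
    DegreeLE d (character p S) := by
  have h : BiasedCube.character p S = fun x => ∑ T ∈ S.powerset,
      ((-(1 / √(p * (1 - p)))) ^ T.card * (p / √(p * (1 - p))) ^ (S \ T).card) *
        BiasedCube.monomial T x := by
    ext x
    have (i : Fin n) : (p - bit x i) / √(p * (1 - p)) =
        -(1 / √(p * (1 - p))) * bit x i + p / √(p * (1 - p)) := by ring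
    simp only [BiasedCube.character, this]
    rw [prod_add]
    refine sum_congr rfl fun T _ => ?_
    rw [prod_mul_distrib, prod_const, prod_const, BiasedCube.monomial]
    ring
  rw [h]
  exact DegreeLE.sum _ fun T hT => (DegreeLE.monomial
    ((card_le_card (mem_powerset.mp hT)).trans hS)).const_mul _

lemma DegreeLE.sub_highPart (hp : p ∈ Set.Ioo (0 : ℝ) 1) (f : Cube n → ℝ) :
    DegreeLE d (fun x => f x - highPart p d f x) := by
  have h : (fun x => f x - highPart p d f x) = fun x =>
      ∑ S with ¬ d < Finset.card S, fourierCoeff p f S * BiasedCube.character p S x := by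
    ext x
    rw [sub_eq_iff_eq_add', highPart, sum_filter_add_sum_filter_not]
    exact eq_sum_fourierCoeff hp f x
  rw [h]
  exact DegreeLE.sum _ fun S hS =>
    (DegreeLE.character (not_lt.mp (mem_filter.mp hS).2)).const_mul _

/-! ### The approximation theorem -/

/-- The constant in the approximation theorem can be chosen to be continuous in `p`: admissible
constants form an upward closed, hence convex set, and are locally uniform. -/
lemma exists_continuousOn_approx (d : ℕ) {A : Finset ℝ} (hA : A.Nonempty) :
    ∃ C : ℝ → ℝ, ContinuousOn C (Set.Ioo 0 1) ∧ ∀ p ∈ Set.Ioo (0 : ℝ) 1,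
      ∀ (n : ℕ) (f : Cube n → ℝ), DegreeLE d f → ∃ g : Cube n → ℝ, DegreeLE d g ∧ ValuedIn A g ∧
        normSq p (fun x => f x - g x) ≤ C p * distSq p f A := by
  let t : Set.Ioo (0 : ℝ) 1 → Set ℝ := fun p => {C | ∀ (n : ℕ) (f : Cube n → ℝ), DegreeLE d f →
    ∃ g : Cube n → ℝ, DegreeLE d g ∧ ValuedIn A g ∧
      normSq p.1 (fun x => f x - g x) ≤ C * distSq p.1 f A}
  have ht (p) : Convex ℝ (t p) := by
    refine IsUpperSet.ordConnected (fun C C' hC h n f hf => ?_) |>.convex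
    obtain ⟨g, hg, hgA, hfg⟩ := h n f hf
    have := distSq_nonneg ⟨p.2.1.le, p.2.2.le⟩ f A
    exact ⟨g, hg, hgA, hfg.trans (by gcongr)⟩
  have hloc (p) : ∃ C, ∀ᶠ q in nhds p, C ∈ t q := by
    have hp : 0 < p.1 * (1 - p.1) := mul_pos p.2.1 (sub_pos.mpr p.2.2)
    obtain ⟨C, hC⟩ := exists_approx d hA (half_pos hp)
    refine ⟨C, ?_⟩
    have hcont : Continuous fun q : Set.Ioo (0 : ℝ) 1 => q.1 * (1 - q.1) := by fun_prop
    filter_upwards [hcont.continuousAt.eventually (Ioi_mem_nhds (half_lt_self hp))] with q hq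
    exact hC q.1 (le_of_lt hq)
  obtain ⟨C, hC⟩ := exists_continuous_forall_mem_convex_of_local_const ht hloc
  refine ⟨fun p => if h : p ∈ Set.Ioo (0 : ℝ) 1 then C ⟨p, h⟩ else 0, ?_, fun p hp => ?_⟩
  · rw [continuousOn_iff_continuous_domRestrict]
    convert C.continuous using 1
    ext p
    simp [p.2.1, p.2.2]
  · simp only [dif_pos hp]
    exact hC ⟨p, hp⟩

end BiasedCube

theorem mainTheorem3 (d : ℕ) (A : Finset ℝ) (hA : A.Nonempty) :
    ∃ (C : ℝ → ℝ) (M : ℕ) (B : ℝ → Finset ℝ) (K : ℝ),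
      ContinuousOn C (Set.Ioo 0 1) ∧
      -- every degree `d` function that is close to `A` is close to an `A`-valued one
      (∀ p ∈ Set.Ioo (0 : ℝ) 1, ∀ (n : ℕ) (f : BiasedCube.Cube n → ℝ),
        BiasedCube.DegreeLE d f →
        ∃ g : BiasedCube.Cube n → ℝ,
          BiasedCube.DegreeLE d g ∧ BiasedCube.ValuedIn A g ∧
          BiasedCube.normSq p (fun x => f x - g x) ≤ C p * BiasedCube.distSq p f A) ∧
      -- `A`-valued functions of degree `d` are juntas with finitely many Fourier coefficients
      (∀ (n : ℕ) (g : BiasedCube.Cube n → ℝ),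
        BiasedCube.DegreeLE d g → BiasedCube.ValuedIn A g →
        BiasedCube.IsJunta M g ∧
        ∀ p ∈ Set.Ioo (0 : ℝ) 1, ∀ S : Finset (Fin n), BiasedCube.fourierCoeff p g S ∈ B p) ∧
      -- the version for `A`-valued functions with a light Fourier tail, uniform measure
      (∀ (n : ℕ) (F : BiasedCube.Cube n → ℝ), BiasedCube.ValuedIn A F →
        ∃ g : BiasedCube.Cube n → ℝ,
          BiasedCube.DegreeLE d g ∧ BiasedCube.ValuedIn A g ∧
          (∀ S : Finset (Fin n), BiasedCube.fourierCoeff (1 / 2) g S ∈ B (1 / 2)) ∧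
          BiasedCube.normSq (1 / 2) (fun x => F x - g x) ≤
            K * BiasedCube.normSq (1 / 2) (BiasedCube.highPart (1 / 2) d F)) := by
  obtain ⟨C, hC, happrox⟩ := BiasedCube.exists_continuousOn_approx d hA
  obtain ⟨M, hM⟩ := BiasedCube.exists_dependsOn d hA
  choose B hB using BiasedCube.exists_fourierCoeff_mem A M
  have hcoeff (n : ℕ) (g : BiasedCube.Cube n → ℝ) (hg : BiasedCube.DegreeLE d g)
      (hgA : BiasedCube.ValuedIn A g) (p : ℝ) (S : Finset (Fin n)) :
      BiasedCube.fourierCoeff p g S ∈ B p := by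
    obtain ⟨J, hJ, hgJ⟩ := hM n g hg hgA
    exact hB p n g hgA J hJ hgJ S
  refine ⟨C, M, B, 2 + 2 * |C (1 / 2)|, hC, happrox, fun n g hg hgA => ⟨?_, ?_⟩, fun n F hF => ?_⟩
  · obtain ⟨J, hJ, hgJ⟩ := hM n g hg hgA
    exact ⟨J, hJ, fun x y h => hgJ h⟩
  · exact fun p _ S => hcoeff n g hg hgA p S
  · have hhalf : (1 / 2 : ℝ) ∈ Set.Ioo (0 : ℝ) 1 := ⟨by norm_num, by norm_num⟩
    have hp : (1 / 2 : ℝ) ∈ Set.Icc (0 : ℝ) 1 := ⟨hhalf.1.le, hhalf.2.le⟩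
    set H := BiasedCube.highPart (1 / 2) d F with hH
    -- the low-degree part of `F` is within `‖H‖` of the `A`-valued function `F`
    obtain ⟨g, hg, hgA, hfg⟩ := happrox (1 / 2) hhalf n _ (BiasedCube.DegreeLE.sub_highPart hhalf F)
    refine ⟨g, hg, hgA, hcoeff n g hg hgA _, ?_⟩
    have hdist : BiasedCube.distSq (1 / 2) (fun x => F x - H x) A ≤
        BiasedCube.normSq (1 / 2) H := by
      refine BiasedCube.expect_mono hp fun x => ?_
      have h := BiasedCube.infDist_le_abs (hF x) (F x - H x)
      rw [sub_sub_cancel_left, abs_neg] at h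
      rw [← sq_abs (H x)]
      exact pow_le_pow_left₀ Metric.infDist_nonneg h 2
    have hadd := BiasedCube.normSq_add_le hp H (fun x => F x - H x - g x)
    have heq : (fun x => H x + (F x - H x - g x)) = fun x => F x - g x := by
      ext x; ring
    rw [heq] at hadd
    have h1 : C (1 / 2) * BiasedCube.distSq (1 / 2) (fun x => F x - H x) A ≤
        |C (1 / 2)| * BiasedCube.normSq (1 / 2) H :=
      mul_le_mul (le_abs_self _) hdist (BiasedCube.distSq_nonneg hp _ _) (abs_nonneg _)
    linarith
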